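/- Let $(W,S)$ be a Coxeter system ($S$ possibly infinite) with length function $l$ and Coxeter matrix $(m_{s,t})$. Let $V$ be a real vector space with a symmetric bilinear form $(\cdot,\cdot)$, and let $\Pi=\{\alpha_s\mid s\in S\}\subseteq V$ be a family of simple roots that is positively independent (a finite combination $\sum c_s\alpha_s=0$ with all $c_s\ge 0$ has all $c_s=0$) with $(\alpha_s,\alpha_s)>0$ for all $s$. Put $|\alpha|=\sqrt{(\alpha,\alpha)}$, and suppose that for $s\neq t$ one has $(\alpha_s,\alpha_t)=-|\alpha_s||\alpha_t|\cos(\pi/m_{s,t})$ if $m_{s,t}<\infty$, $(\alpha_s,\alpha_t)\le -|\alpha_s||\alpha_t|$ if $m_{s,t}=\infty$, and $|\alpha_s|=|\alpha_t|$ if $m_{s,t}$ is odd. Then $W$ acts on $V$, with $s\in S$ acting as the orthogonal reflection in $\alpha_s$. Let $\Phi=\{w(\alpha_s)\mid w\in W,\ s\in S\}$ be the root system, $\Phi_+$ the set of roots that are nonnegative linear combinations of $\Pi$, $\Phi_-=-\Phi_+$, and $\Phi_z=\Phi_+\cap z(\Phi_-)$ for $z\in W$. Let $\le$ be the weak (right)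 order on $W$: $x\le y$ if and only if $l(y)=l(x)+l(x^{-1}y)$. Joins $\vee$ and meets $\wedge$ are taken in $(W,\le)$; an equation $x\vee z=w$ means that the join exists and equals $w$. Define a relation $R$ on $W$ by $xRz$ if and only if $z(\Phi_x)=\Phi_x$. For $X,Z\subseteq W$ let $$X^\dagger=\{z\in W\mid xRz\text{ for all }x\in X\},\qquad Z^*=\{x\in W\mid xRz\text{ for all }z\in Z\},$$ and let $\mathcal W_\dagger=\{G\subseteq W\mid G^{*\dagger}=G\}$ and $\mathcal W_*=\{L\subseteq W\mid L^{\dagger *}=L\}$. **Theorem.** (a) For all $x,z\in W$, $$xRz\iff\bigl(x\vee z=zx\text{ and }\Phi_x\cap\Phi_z=\emptyset\bigr)\iff\Phi_{zx}=\Phi_z\sqcup\Phi_x,$$ where $\sqcup$ denotes a union of disjoint sets. (b) If $xRz$, then $xRz^{-1}$ and $l(zx)=l(z)+l(x)$. (c) Every element of $\mathcal W_\dagger$ is a subgroup of $W$. (d) Every $L\in\mathcal W_*$ is a complete meet subsemilattice of $(W,\le)$ (every non-empty subset of $L$ has a meet in $W$, and this meet lies in $L$), and $1_W$ is the minimum element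 of $L$. (e) If $L\in\mathcal W_*$ and $X\subseteq L$ has an upper bound in $W$, then $X$ has a join $x=\bigvee X$ in $W$, and $x\in L$ (so $x$ is also the least upper bound of $X$ in $L$). -/

import Mathlib

/-- A based root system of type `M` in a real vector space `V`: a symmetric bilinear form together
with a family of positively independent simple roots `α i` of positive norm such that, for `i ≠ j`,
`(α i, α j) = - |α i| |α j| cos (π / M i j)` when `M i j` is finite, and
`(α i, α j) ≤ - |α i| |α j|` when `M i j = ∞` (which is encoded by the value `0`). Here
`|α| = √(α, α)`. The simple roots need not be linearly independent, need not span `V`, and need not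
have norm one; the condition on odd `M i j` makes the resulting root system reduced. -/
structure BasedRootSystem {B : Type*} (M : CoxeterMatrix B) (V : Type*)
    [AddCommGroup V] [Module ℝ V] where
  /-- the bilinear form -/
  form : LinearMap.BilinForm ℝ V
  /-- the simple roots -/
  simpleRoot : B → V
  form_symm : ∀ u v, form u v = form v u
  form_self_pos : ∀ i, 0 < form (simpleRoot i) (simpleRoot i)
  form_self_eq_of_odd : ∀ i j, Odd (M i j) →
    form (simpleRoot i) (simpleRoot i) = form (simpleRoot j) (simpleRoot j)
  form_of_finite : ∀ i j, i ≠ j → M i j ≠ 0 →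
    form (simpleRoot i) (simpleRoot j) =
      -(√(form (simpleRoot i) (simpleRoot i)) * √(form (simpleRoot j) (simpleRoot j)) *
        Real.cos (Real.pi / (M i j : ℝ)))
  form_of_infinite : ∀ i j, i ≠ j → M i j = 0 →
    form (simpleRoot i) (simpleRoot j) ≤
      -(√(form (simpleRoot i) (simpleRoot i)) * √(form (simpleRoot j) (simpleRoot j)))
  pos_indep : ∀ c : B →₀ ℝ, (∀ i, 0 ≤ c i) → (c.sum fun i a => a • simpleRoot i) = 0 → c = 0

namespace BasedRootSystem

variable {B V : Type*} [AddCommGroup V] [Module ℝ V] {M : CoxeterMatrix B}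

/-- The simple coroot, as the linear form `v ↦ 2 (α i, v) / (α i, α i)`. -/
noncomputable def simpleCoroot (D : BasedRootSystem M V) (i : B) : Module.Dual ℝ V :=
  (2 / D.form (D.simpleRoot i) (D.simpleRoot i)) • D.form (D.simpleRoot i)

theorem simpleCoroot_apply (D : BasedRootSystem M V) (i : B) (v : V) :
    D.simpleCoroot i v =
      2 / D.form (D.simpleRoot i) (D.simpleRoot i) * D.form (D.simpleRoot i) v := rfl

theorem simpleCoroot_self (D : BasedRootSystem M V) (i : B) :
    D.simpleCoroot i (D.simpleRoot i) = 2 := by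
  rw [simpleCoroot_apply, div_mul_cancel₀ _ (D.form_self_pos i).ne']

/-- The orthogonal reflection in the simple root `α i`. -/
noncomputable def simpleReflection (D : BasedRootSystem M V) (i : B) : V ≃ₗ[ℝ] V :=
  Module.reflection (D.simpleCoroot_self i)

theorem simpleCoroot_mul (D : BasedRootSystem M V) {i j : B} (h : i ≠ j) (hM : M i j ≠ 0) :
    D.simpleCoroot i (D.simpleRoot j) * D.simpleCoroot j (D.simpleRoot i) - 2 =
      2 * Real.cos (2 * (Real.pi / (M i j : ℝ))) := by
  have hi := D.form_self_pos i
  have hj := D.form_self_pos j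
  rw [simpleCoroot_apply, simpleCoroot_apply, D.form_symm (D.simpleRoot j) (D.simpleRoot i),
    D.form_of_finite i j h hM, Real.cos_two_mul]
  have ei := Real.sq_sqrt hi.le
  have ej := Real.sq_sqrt hj.le
  generalize √(D.form (D.simpleRoot i) (D.simpleRoot i)) = a at *
  generalize √(D.form (D.simpleRoot j) (D.simpleRoot j)) = b at *
  rw [← ei] at hi ⊢
  rw [← ej] at hj ⊢
  have ha : a ≠ 0 := by rintro rfl; simp at hi
  have hb : b ≠ 0 := by rintro rfl; simp at hj
  field_simp

/-- The simple reflections satisfy the Coxeter relations. -/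
theorem isLiftable (D : BasedRootSystem M V) : M.IsLiftable D.simpleReflection := by
  intro i j
  by_cases h : i = j
  · subst h
    ext v
    simp only [M.diagonal, pow_one, LinearEquiv.mul_apply, LinearEquiv.coe_one, id_eq]
    exact Module.involutive_reflection (D.simpleCoroot_self i) v
  by_cases hM : M i j = 0
  · rw [hM, pow_zero]
  have hM1 : M i j ≠ 1 := M.off_diagonal i j h
  have ht := D.simpleCoroot_mul h hM
  by_cases hM2 : M i j = 2
  · have h0 : D.form (D.simpleRoot i) (D.simpleRoot j) = 0 := by
      rw [D.form_of_finite i j h hM, hM2]; simp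
    have h1 : D.simpleCoroot i (D.simpleRoot j) = 0 := by rw [simpleCoroot_apply, h0, mul_zero]
    have h2 : D.simpleCoroot j (D.simpleRoot i) = 0 := by
      rw [simpleCoroot_apply, D.form_symm (D.simpleRoot j) (D.simpleRoot i), h0, mul_zero]
    have h3 := D.simpleCoroot_self i
    have h4 := D.simpleCoroot_self j
    ext v
    simp only [hM2, pow_two, LinearEquiv.mul_apply, LinearEquiv.coe_one, id_eq, simpleReflection,
      Module.reflection_apply, map_sub, map_smul, h1, h2, h3, h4]
    module
  · set m := M i j with hm
    set θ : ℝ := 2 * (Real.pi / (m : ℝ)) with hθ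
    have hm3 : 3 ≤ m := by omega
    have hm0 : (0 : ℝ) < m := by positivity
    have hm3' : (3 : ℝ) ≤ m := by exact_mod_cast hm3
    have hmθ : (m : ℝ) * θ = 2 * Real.pi := by rw [hθ]; field_simp
    have hsin : Real.sin θ ≠ 0 := by
      apply ne_of_gt
      apply Real.sin_pos_of_pos_of_lt_pi
      · rw [hθ]; positivity
      · nlinarith [Real.pi_pos]
    have hS : ∀ n : ℤ, (Polynomial.Chebyshev.S ℝ n).eval (2 * Real.cos θ) =
        Real.sin ((n + 1) * θ) / Real.sin θ := fun n => by
      rw [eq_div_iff hsin, Polynomial.Chebyshev.S_two_mul_real_cos]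
    ext v
    rw [simpleReflection, simpleReflection,
      Module.reflection_mul_reflection_pow_apply _ _ m v (2 * Real.cos θ) ht.symm]
    simp only [LinearEquiv.coe_one, id_eq]
    rcases Nat.even_or_odd' m with ⟨k, hk | hk⟩
    · have e1 : ((m : ℤ) - 2) / 2 = (k : ℤ) - 1 := by omega
      have e2 : ((m : ℤ) - 1) / 2 = (k : ℤ) - 1 := by omega
      have hk' : (k : ℝ) * θ = Real.pi := by
        rw [hk] at hmθ; push_cast at hmθ; linarith
      have h0 : (Polynomial.Chebyshev.S ℝ ((k : ℤ) - 1)).eval (2 * Real.cos θ) = 0 := by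
        rw [hS]; push_cast; rw [sub_add_cancel, hk', Real.sin_pi, zero_div]
      rw [e1, e2, h0]
      simp
    · have e1 : ((m : ℤ) - 2) / 2 = (k : ℤ) - 1 := by omega
      have e2 : ((m : ℤ) - 1) / 2 = (k : ℤ) := by omega
      have e3 : ((m : ℤ) - 3) / 2 = (k : ℤ) - 1 := by omega
      have e4 : (m : ℤ) / 2 = (k : ℤ) := by omega
      have hk' : ((k : ℝ) + 1) * θ = 2 * Real.pi - (k : ℝ) * θ := by
        rw [hk] at hmθ; push_cast at hmθ; linarith
      have h0 : (Polynomial.Chebyshev.S ℝ (k : ℤ)).eval (2 * Real.cos θ) +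
          (Polynomial.Chebyshev.S ℝ ((k : ℤ) - 1)).eval (2 * Real.cos θ) = 0 := by
        rw [hS, hS]; push_cast
        rw [sub_add_cancel, hk', Real.sin_two_pi_sub]; ring
      rw [e1, e2, e3, e4, h0]
      simp

variable {W : Type*} [Group W]

/-- The action of `W` on `V`, in which the simple generators act as the simple reflections. -/
noncomputable def rep (D : BasedRootSystem M V) (cs : CoxeterSystem M W) : W →* (V ≃ₗ[ℝ] V) :=
  cs.lift ⟨D.simpleReflection, D.isLiftable⟩

/-- The set `Φ` of roots: the images of the simple roots under `W`. -/
def roots (D : BasedRootSystem M V) (cs : CoxeterSystem M W) : Set V :=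
  {v | ∃ (w : W) (i : B), v = D.rep cs w (D.simpleRoot i)}

/-- The set `Φ₊` of positive roots: the roots that are nonnegative linear combinations of simple
roots. -/
def posRoots (D : BasedRootSystem M V) (cs : CoxeterSystem M W) : Set V :=
  {v | v ∈ D.roots cs ∧ ∃ c : B →₀ ℝ, (∀ i, 0 ≤ c i) ∧ v = c.sum fun i a => a • D.simpleRoot i}

/-- The set `Φ₋ = -Φ₊` of negative roots. -/
def negRoots (D : BasedRootSystem M V) (cs : CoxeterSystem M W) : Set V :=
  {v | -v ∈ D.posRoots cs}

/-- The inversion set `Φ_z = Φ₊ ∩ z(Φ₋)`. -/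
def inversions (D : BasedRootSystem M V) (cs : CoxeterSystem M W) (z : W) : Set V :=
  D.posRoots cs ∩ D.rep cs z '' D.negRoots cs

/-- The relation `x R z`: `z(Φ_x) = Φ_x`. -/
def R (D : BasedRootSystem M V) (cs : CoxeterSystem M W) (x z : W) : Prop :=
  D.rep cs z '' D.inversions cs x = D.inversions cs x

/-- `X† = {z | x R z for all x ∈ X}`. -/
def dagger (D : BasedRootSystem M V) (cs : CoxeterSystem M W) (X : Set W) : Set W :=
  {z | ∀ x ∈ X, D.R cs x z}

/-- `Z* = {x | x R z for all z ∈ Z}`. -/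
def star (D : BasedRootSystem M V) (cs : CoxeterSystem M W) (Z : Set W) : Set W :=
  {x | ∀ z ∈ Z, D.R cs x z}

/-- The family `W_†` of subsets `G` of `W` with `G*† = G`. -/
def stableDagger (D : BasedRootSystem M V) (cs : CoxeterSystem M W) : Set (Set W) :=
  {G | D.dagger cs (D.star cs G) = G}

/-- The family `W_*` of subsets `L` of `W` with `L†* = L`. -/
def stableStar (D : BasedRootSystem M V) (cs : CoxeterSystem M W) : Set (Set W) :=
  {L | D.star cs (D.dagger cs L) = L}

end BasedRootSystem

/-- The weak (right) order of a Coxeter system: `x ≤ y` iff `l(y) = l(x) + l(x⁻¹ y)`. It is not an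
instance. -/
@[reducible] def CoxeterSystem.weakOrder {B W : Type*} [Group W] {M : CoxeterMatrix B}
    (cs : CoxeterSystem M W) : PartialOrder W where
  le x y := cs.length y = cs.length x + cs.length (x⁻¹ * y)
  le_refl x := by simp
  le_trans x y z hxy hyz := by
    have h1 := cs.length_mul_le (x⁻¹ * y) (y⁻¹ * z)
    have h2 := cs.length_mul_le x (x⁻¹ * z)
    rw [mul_assoc, mul_inv_cancel_left] at h1
    rw [mul_inv_cancel_left] at h2
    omega
  le_antisymm x y hxy hyx := by
    have h : cs.length (x⁻¹ * y) = 0 := by omega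
    rw [cs.length_eq_zero_iff] at h
    exact (inv_mul_eq_one.mp h)

/-- A subset `L` of a poset such that every nonempty subset of `L` has a meet in the whole poset,
and this meet belongs to `L`. -/
def IsCompleteMeetSubsemilattice {α : Type*} [PartialOrder α] (L : Set α) : Prop :=
  ∀ Y : Set α, Y ⊆ L → Y.Nonempty → ∃ m ∈ L, IsGLB Y m

namespace BasedRootSystem

open CoxeterSystem

/-! ### The cone of nonnegative combinations of simple roots -/

variable {B V : Type*} [AddCommGroup V] [Module ℝ V] {M : CoxeterMatrix B}
variable {W : Type*} [Group W]

/-! Everything is read off inversion sets. The root w(α_s) is positive or negative according as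
l(ws) > l(w) or not (`rep_simpleRoot_mem_posCone`). Hence |Φ_z| = l(z), and Φ_{zx} ⊆ Φ_z ⊔ z(Φ_x)
with equality exactly when z(Φ_x) is positive, that is, when lengths add; so the weak order is
inclusion of inversion sets. If z(Φ_x) = Φ_x, this reads Φ_{zx} = Φ_z ⊔ Φ_x, and conversely Φ_z can
be cancelled from the two decompositions. The z stabilizing given sets Φ_x form a group.

For joins, convexity is the key: a bounded family has a join j with Φ_j inside the cone spanned by
the union A of its inversion sets (`exists_isConicJoin`). Inversion sets absorb roots in the cone of
their subsets, so Φ_j consists of all roots in that cone. An element permuting A therefore permutes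
Φ_j (`R_join`).

For a meet m of elements y related to z, the join of z and m lies below every zy, so it equals zk
with k ≤ m; counting roots forces k = m (`R_meet`).

Simple roots may be linearly dependent, so coefficients of a root are not well defined. The
substitute is that each simple root spans an extreme ray of the cone
(`coeff_eq_zero_of_smul_eq_sum`). -/

theorem _root_.Submodule.real_smul_mem_of_nnreal (C : Submodule NNReal V) {a : ℝ} (ha : 0 ≤ a)
    {v : V} (hv : v ∈ C) : a • v ∈ C :=
  C.smul_mem (⟨a, ha⟩ : NNReal) hv

/-- The convex cone spanned by the simple roots. -/
def posCone (D : BasedRootSystem M V) : Submodule NNReal V :=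
  Submodule.span NNReal (Set.range D.simpleRoot)

theorem simpleRoot_mem_posCone (D : BasedRootSystem M V) (i : B) : D.simpleRoot i ∈ D.posCone :=
  Submodule.subset_span ⟨i, rfl⟩

theorem mem_posCone_iff (D : BasedRootSystem M V) {v : V} :
    v ∈ D.posCone ↔
      ∃ c : B →₀ ℝ, (∀ i, 0 ≤ c i) ∧ v = c.sum fun i a => a • D.simpleRoot i := by
  constructor
  · intro h
    obtain ⟨c, rfl⟩ := Finsupp.mem_span_range_iff_exists_finsupp.mp h
    refine ⟨c.mapRange (fun a : NNReal => (a : ℝ)) NNReal.coe_zero, fun i => ?_, ?_⟩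
    · rw [Finsupp.mapRange_apply]; exact NNReal.coe_nonneg _
    · rw [Finsupp.sum_mapRange_index (fun i => zero_smul ℝ (D.simpleRoot i))]
      rfl
  · rintro ⟨c, hc, rfl⟩
    exact Submodule.sum_mem _ fun i _ =>
      D.posCone.real_smul_mem_of_nnreal (hc i) (D.simpleRoot_mem_posCone i)

theorem sum_add (D : BasedRootSystem M V) (c d : B →₀ ℝ) :
    ((c + d).sum fun i a => a • D.simpleRoot i) =
      (c.sum fun i a => a • D.simpleRoot i) + d.sum fun i a => a • D.simpleRoot i :=
  Finsupp.sum_add_index' (by simp) (by simp [add_smul])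

theorem sum_single (D : BasedRootSystem M V) (i : B) (a : ℝ) :
    ((Finsupp.single i a).sum fun i a => a • D.simpleRoot i) = a • D.simpleRoot i :=
  Finsupp.sum_single_index (by simp)

theorem simpleRoot_ne_zero (D : BasedRootSystem M V) (i : B) : D.simpleRoot i ≠ 0 := fun h => by
  simpa [h] using D.form_self_pos i

theorem eq_zero_of_mem_posCone (D : BasedRootSystem M V) {v : V} (h : v ∈ D.posCone)
    (h' : -v ∈ D.posCone) : v = 0 := by
  obtain ⟨c, hc, rfl⟩ := D.mem_posCone_iff.mp h
  obtain ⟨d, hd, e⟩ := D.mem_posCone_iff.mp h'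
  have h0 : c + d = 0 := D.pos_indep _ (fun i => add_nonneg (hc i) (hd i)) (by
    rw [sum_add, ← e, add_neg_cancel])
  have : c = 0 := by
    ext i
    have := DFunLike.congr_fun h0 i
    simp only [Finsupp.add_apply, Finsupp.zero_apply] at this
    have := hc i
    have := hd i
    simp only [Finsupp.zero_apply]
    linarith
  simp [this]

theorem form_nonpos (D : BasedRootSystem M V) {i j : B} (h : i ≠ j) :
    D.form (D.simpleRoot i) (D.simpleRoot j) ≤ 0 := by
  have hs : 0 ≤ √(D.form (D.simpleRoot i) (D.simpleRoot i)) *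
      √(D.form (D.simpleRoot j) (D.simpleRoot j)) := by positivity
  by_cases hM : M i j = 0
  · have := D.form_of_infinite i j h hM
    linarith
  · rw [D.form_of_finite i j h hM]
    have h1 := M.off_diagonal i j h
    have h2 : (2 : ℝ) ≤ (M i j : ℝ) := by exact_mod_cast (by omega : 2 ≤ M i j)
    have : 0 ≤ Real.cos (Real.pi / (M i j : ℝ)) := by
      apply Real.cos_nonneg_of_mem_Icc
      constructor
      · have : 0 ≤ Real.pi / (M i j : ℝ) := by positivity
        linarith [Real.pi_pos]
      · exact div_le_div_of_nonneg_left Real.pi_pos.le two_pos h2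
    have := mul_nonneg hs this
    linarith

/-- Each simple root spans an extreme ray of the positive cone. -/
theorem coeff_eq_zero_of_smul_eq_sum (D : BasedRootSystem M V) {t : B} {b : ℝ} {d : B →₀ ℝ}
    (hd : ∀ i, 0 ≤ d i) (h : b • D.simpleRoot t = d.sum fun i a => a • D.simpleRoot i)
    {i : B} (hi : i ≠ t) : d i = 0 := by
  classical
  -- If b ≤ d t, moving b α_t across gives a vanishing nonnegative combination. If b > d t, pairing
  -- with α_t is contradictory, since the other terms contribute nonpositively.
  rcases le_or_gt b (d t) with hb | hb
  · have h0 : d + Finsupp.single t (-b) = 0 := by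
      apply D.pos_indep
      · intro j
        rw [Finsupp.add_apply, Finsupp.single_apply]
        split_ifs with hj
        · subst hj; linarith
        · simpa using hd j
      · rw [sum_add, sum_single, ← h]; module
    have := DFunLike.congr_fun h0 i
    simpa [Finsupp.single_apply, hi.symm] using this
  · exfalso
    have e := congrArg (D.form (D.simpleRoot t)) h
    rw [map_smul, Finsupp.sum, map_sum] at e
    have h1 : ∀ j ∈ d.support, D.form (D.simpleRoot t) (d j • D.simpleRoot j) ≤
        if j = t then d t * D.form (D.simpleRoot t) (D.simpleRoot t) else 0 := by
      intro j _
      rw [map_smul, smul_eq_mul]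
      split_ifs with hj
      · rw [hj]
      · exact mul_nonpos_of_nonneg_of_nonpos (hd j) (D.form_nonpos (Ne.symm hj))
    have h2 := Finset.sum_le_sum h1
    rw [← e, Finset.sum_ite_eq', smul_eq_mul] at h2
    have hp := D.form_self_pos t
    have h3 := mul_lt_mul_of_pos_right hb hp
    split_ifs at h2 with hs
    · linarith
    · rw [Finsupp.notMem_support_iff] at hs
      rw [hs] at h3
      linarith

/-- Were a negative, moving a α_s across would write b α_t as a nonnegative combination with
positive coefficient at s, against extremality of the ray of α_t. -/
theorem nonneg_of_add_smul_mem_posCone (D : BasedRootSystem M V) {s t : B} (hst : s ≠ t) {a b : ℝ}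
    (h : a • D.simpleRoot s + b • D.simpleRoot t ∈ D.posCone) : 0 ≤ a := by
  by_contra! ha
  obtain ⟨c, hc, e⟩ := D.mem_posCone_iff.mp h
  have h1 := D.coeff_eq_zero_of_smul_eq_sum (t := t) (b := b) (d := c + Finsupp.single s (-a))
    (fun i => add_nonneg (hc i) ((Finsupp.single_nonneg (i := s)).mpr (by linarith : 0 ≤ -a) i))
    (by rw [sum_add, sum_single, ← e]; module) hst
  rw [Finsupp.add_apply, Finsupp.single_eq_same] at h1
  have := hc s
  linarith

/-! ### Lengths and the signs of roots -/

section Action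

variable (D : BasedRootSystem M V) (cs : CoxeterSystem M W)

theorem rep_simple (i : B) : D.rep cs (cs.simple i) = D.simpleReflection i :=
  cs.lift_apply_simple _ i

theorem rep_simple_apply (i : B) (v : V) :
    D.rep cs (cs.simple i) v = v - D.simpleCoroot i v • D.simpleRoot i := by
  rw [rep_simple, simpleReflection, Module.reflection_apply]

theorem rep_mul_apply (x y : W) (v : V) : D.rep cs (x * y) v = D.rep cs x (D.rep cs y v) := by
  rw [map_mul, LinearEquiv.mul_apply]

theorem rep_one_apply (v : V) : D.rep cs 1 v = v := by
  rw [map_one, LinearEquiv.coe_one, id]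

theorem rep_inv_rep (w : W) (v : V) : D.rep cs w⁻¹ (D.rep cs w v) = v := by
  rw [← rep_mul_apply, inv_mul_cancel, rep_one_apply]

theorem rep_rep_inv (w : W) (v : V) : D.rep cs w (D.rep cs w⁻¹ v) = v := by
  rw [← rep_mul_apply, mul_inv_cancel, rep_one_apply]

theorem rep_simple_simpleRoot (i : B) :
    D.rep cs (cs.simple i) (D.simpleRoot i) = -D.simpleRoot i := by
  rw [rep_simple_apply, simpleCoroot_self]; module

theorem rep_simple_rep_simple (i : B) (v : V) :
    D.rep cs (cs.simple i) (D.rep cs (cs.simple i) v) = v := by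
  rw [← rep_mul_apply, cs.simple_mul_simple_self, rep_one_apply]

/-- The orbit of `α s` under alternating products, in terms of a sequence of Chebyshev type. -/
theorem rep_alternatingWord {s t : B} {κ : ℝ} {u : ℕ → ℝ}
    (hκ : D.form (D.simpleRoot s) (D.simpleRoot t) =
      -(√(D.form (D.simpleRoot s) (D.simpleRoot s)) *
        √(D.form (D.simpleRoot t) (D.simpleRoot t)) * κ))
    (h0 : u 0 = 0) (h1 : u 1 = 1) (hu : ∀ n, u (n + 2) = 2 * κ * u (n + 1) - u n) (k : ℕ) :
    D.rep cs (cs.wordProd (alternatingWord s t k)) (D.simpleRoot s) =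
      u (if Even k then k + 1 else k) • D.simpleRoot s +
      (u (if Even k then k else k + 1) * (√(D.form (D.simpleRoot s) (D.simpleRoot s)) /
        √(D.form (D.simpleRoot t) (D.simpleRoot t)))) • D.simpleRoot t := by
  have hs := D.form_self_pos s
  have ht := D.form_self_pos t
  have es := Real.sq_sqrt hs.le
  have et := Real.sq_sqrt ht.le
  have cs' := D.simpleCoroot_apply s (D.simpleRoot t)
  have ct := D.simpleCoroot_apply t (D.simpleRoot s)
  rw [hκ] at cs'
  rw [D.form_symm (D.simpleRoot t) (D.simpleRoot s), hκ] at ct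
  have ps := Real.sqrt_pos.mpr hs
  have pt := Real.sqrt_pos.mpr ht
  generalize √(D.form (D.simpleRoot s) (D.simpleRoot s)) = c at *
  generalize √(D.form (D.simpleRoot t) (D.simpleRoot t)) = d at *
  have h2 : D.rep cs (cs.simple s) (D.simpleRoot t) =
      D.simpleRoot t + (2 * κ * (d / c)) • D.simpleRoot s := by
    rw [rep_simple_apply, cs', ← es, sub_eq_add_neg, ← neg_smul]
    congr 2; field_simp
  have h3 : D.rep cs (cs.simple t) (D.simpleRoot s) =
      D.simpleRoot s + (2 * κ * (c / d)) • D.simpleRoot t := by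
    rw [rep_simple_apply, ct, ← et, sub_eq_add_neg, ← neg_smul]
    congr 2; field_simp
  induction k with
  | zero => simp [alternatingWord, h0, h1]
  | succ k ih =>
    rw [alternatingWord_succ', cs.wordProd_cons, rep_mul_apply, ih]
    have hk := hu k
    by_cases he : Even k
    · have ho : ¬ Even (k + 1) := by simpa [Nat.even_add_one] using he
      simp only [he, ho, if_true, if_false, map_add, map_smul, rep_simple_simpleRoot, h3, hk]
      match_scalars <;> field_simp
      ring
    · have ho : Even (k + 1) := by simpa [Nat.even_add_one] using he
      simp only [he, ho, if_true, if_false, map_add, map_smul, rep_simple_simpleRoot, h2, hk]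
      match_scalars <;> field_simp
      ring

/-- The coefficients are values of a Chebyshev-type sequence: sin(nθ)/sin θ with θ = π/m for finite
m, nonnegative for n ≤ m, and a nondecreasing sequence for m = ∞, where κ ≥ 1. -/
theorem exists_rep_alternatingWord_eq {s t : B} (hst : s ≠ t) {k : ℕ}
    (hk : M s t = 0 ∨ k < M s t) : ∃ a b : ℝ, 0 ≤ a ∧ 0 ≤ b ∧
      D.rep cs (cs.wordProd (alternatingWord s t k)) (D.simpleRoot s) =
        a • D.simpleRoot s + b • D.simpleRoot t := by
  suffices h : ∃ (κ : ℝ) (u : ℕ → ℝ), D.form (D.simpleRoot s) (D.simpleRoot t) =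
      -(√(D.form (D.simpleRoot s) (D.simpleRoot s)) *
        √(D.form (D.simpleRoot t) (D.simpleRoot t)) * κ) ∧ u 0 = 0 ∧ u 1 = 1 ∧
      (∀ n, u (n + 2) = 2 * κ * u (n + 1) - u n) ∧ ∀ n ≤ k + 1, 0 ≤ u n by
    obtain ⟨κ, u, hκ, h0, h1, hu, hn⟩ := h
    refine ⟨_, _, ?_, ?_, D.rep_alternatingWord cs hκ h0 h1 hu k⟩
    · apply hn; split_ifs <;> omega
    · apply mul_nonneg _ (by positivity)
      apply hn; split_ifs <;> omega
  by_cases hM : M s t = 0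
  · have hf := D.form_of_infinite s t hst hM
    have ps := Real.sqrt_pos.mpr (D.form_self_pos s)
    have pt := Real.sqrt_pos.mpr (D.form_self_pos t)
    generalize √(D.form (D.simpleRoot s) (D.simpleRoot s)) = c at *
    generalize √(D.form (D.simpleRoot t) (D.simpleRoot t)) = d at *
    generalize D.form (D.simpleRoot s) (D.simpleRoot t) = f at *
    obtain ⟨κ, rfl⟩ : ∃ κ, f = -(c * d * κ) := ⟨-f / (c * d), by field_simp⟩
    have hκ : 1 ≤ κ := by
      have hcd : 0 < c * d := by positivity
      by_contra! h
      nlinarith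
    let u : ℕ → ℝ := fun n =>
      (Nat.rec (0, 1) (fun _ p => (p.2, 2 * κ * p.2 - p.1)) n : ℝ × ℝ).1
    have hu : ∀ n, 0 ≤ u n ∧ u n ≤ u (n + 1) := by
      intro n
      induction n with
      | zero => simp [u]
      | succ n ih =>
        have h2 : u (n + 2) = 2 * κ * u (n + 1) - u n := rfl
        refine ⟨by linarith, ?_⟩
        rw [h2]
        nlinarith
    exact ⟨κ, u, rfl, rfl, rfl, fun _ => rfl, fun n _ => (hu n).1⟩
  · have hk' := hk.resolve_left hM
    have h1 := M.off_diagonal s t hst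
    have hm : 2 ≤ M s t := by omega
    have hf := D.form_of_finite s t hst hM
    generalize M s t = m at *
    have hm0 : (0 : ℝ) < m := by exact_mod_cast (by omega : 0 < m)
    set θ := Real.pi / (m : ℝ) with hθ
    have hmθ : m * θ = Real.pi := by rw [hθ]; field_simp
    have hθ0 : 0 < θ := by have := Real.pi_pos; positivity
    have hm2 : (2 : ℝ) ≤ m := by exact_mod_cast hm
    have hsin : 0 < Real.sin θ := Real.sin_pos_of_pos_of_lt_pi hθ0 (by nlinarith)
    refine ⟨Real.cos θ, fun n => Real.sin (n * θ) / Real.sin θ, hf, by simp, ?_, fun n => ?_,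
      fun n hn => ?_⟩
    · simp [hsin.ne']
    · have e : Real.sin ((n + 2 : ℕ) * θ) =
          2 * Real.cos θ * Real.sin ((n + 1 : ℕ) * θ) - Real.sin (n * θ) := by
        have e1 : ((n + 2 : ℕ) : ℝ) * θ = (n + 1 : ℕ) * θ + θ := by push_cast; ring
        have e2 : (n : ℝ) * θ = (n + 1 : ℕ) * θ - θ := by push_cast; ring
        rw [e1, e2, Real.sin_add, Real.sin_sub]; ring
      simp only [e]; ring
    · apply div_nonneg _ hsin.le
      apply Real.sin_nonneg_of_nonneg_of_le_pi (by positivity)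
      rw [← hmθ]
      gcongr
      omega

/-- If `l(w) < l(w s)` then `w` sends the simple root `α s` into the positive cone. -/
theorem rep_simpleRoot_mem_posCone {w : W} {s : B} (hw : ¬ cs.IsRightDescent w s) :
    D.rep cs w (D.simpleRoot s) ∈ D.posCone := by
  classical
  induction hn : cs.length w using Nat.strong_induction_on generalizing w s with
  | _ n IH =>
  subst hn
  by_cases h1 : w = 1
  · rw [h1, rep_one_apply]; exact D.simpleRoot_mem_posCone s
  obtain ⟨t, ht⟩ := cs.exists_rightDescent_of_ne_one h1
  have hst : s ≠ t := by rintro rfl; exact hw ht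
  -- The alternating product of k letters ending in t.
  let p : ℕ → W := fun k => cs.wordProd (alternatingWord s t k)
  have hp : ∀ k, cs.length (p k) ≤ k := fun k =>
    (cs.length_wordProd_le _).trans (by simp)
  have hps : ∀ k, p (k + 1) = cs.simple (if Even k then t else s) * p k := fun k => by
    simp only [p]; rw [alternatingWord_succ', cs.wordProd_cons]
  have hwk : ∀ k, cs.length w ≤ cs.length (w * (p k)⁻¹) + k := fun k => by
    have := cs.length_mul_le (w * (p k)⁻¹) (p k)
    rw [inv_mul_cancel_right] at this
    have := hp k
    omega
  -- Q k says that p k splits off w on the right with lengths adding. For the largest such k, the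
  -- remaining factor v has neither s nor t as a right descent, so induction applies to both v(α_s)
  -- and v(α_t).
  obtain ⟨Q, hQ⟩ : ∃ Q : ℕ → Prop,
      ∀ k, Q k ↔ cs.length (w * (p k)⁻¹) + k = cs.length w := ⟨_, fun _ => Iff.rfl⟩
  have hQ1 : Q 1 := by
    have : p 1 = cs.simple t := by simp [p, alternatingWord]
    rw [hQ, this, cs.inv_simple]
    exact cs.isRightDescent_iff.mp ht
  have hpos : 1 ≤ cs.length w := by rw [hQ] at hQ1; omega
  obtain ⟨k, hk1, hQk, hmax⟩ : ∃ k, 1 ≤ k ∧ Q k ∧ ¬ Q (k + 1) := by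
    refine ⟨Nat.findGreatest Q (cs.length w), ?_, ?_, fun h => ?_⟩
    · exact Nat.le_findGreatest hpos hQ1
    · exact Nat.findGreatest_spec hpos hQ1
    · have : Nat.findGreatest Q (cs.length w) + 1 ≤ cs.length w := by rw [hQ] at h; omega
      have := Nat.le_findGreatest this h
      omega
  set v := w * (p k)⁻¹ with hv
  have hvw : w = v * p k := by rw [hv, inv_mul_cancel_right]
  have hlv : cs.length v + k = cs.length w := (hQ k).mp hQk
  have ha : ¬ cs.IsRightDescent v (if Even k then t else s) := fun h => hmax <| by
    rw [hQ, hps, mul_inv_rev, cs.inv_simple, ← mul_assoc, ← hv]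
    have := cs.isRightDescent_iff.mp h
    omega
  have hb : ¬ cs.IsRightDescent v (if Even k then s else t) := fun h => by
    obtain ⟨k', rfl⟩ := Nat.exists_eq_add_of_le' hk1
    have e : v * cs.simple (if Even (k' + 1) then s else t) = w * (p k')⁻¹ := by
      have : (if Even (k' + 1) then s else t) = if Even k' then t else s := by
        simp only [Nat.even_add_one, ite_not]
      rw [hv, hps, this, mul_inv_rev, cs.inv_simple, mul_assoc, cs.simple_mul_simple_cancel_right]
    have h2 := cs.isRightDescent_iff.mp h
    rw [e] at h2
    have := hwk k'
    omega
  -- Otherwise p (M s t) would split off w; by the braid relation it also ends in s, so s would be a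
  -- right descent of w.
  have hkM : M s t = 0 ∨ k < M s t := by
    by_contra! h
    obtain ⟨hM, hMk⟩ := h
    have hQM : ∀ i j, j + i = k → Q j := fun i => by
      induction i with
      | zero => rintro j rfl; exact hQk
      | succ i ih =>
        intro j hj
        have h2 := ih (j + 1) (by omega)
        have h3 := hwk j
        rw [hQ] at h2 ⊢
        have h4 := cs.length_mul_le (w * (p j)⁻¹ * cs.simple (if Even j then t else s))
          (cs.simple (if Even j then t else s))
        rw [hps, mul_inv_rev, cs.inv_simple, ← mul_assoc] at h2
        rw [cs.simple_mul_simple_cancel_right, cs.length_simple] at h4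
        omega
    have hQM' := (hQ _).mp (hQM (k - M s t) (M s t) (by omega))
    obtain ⟨m, hm⟩ := Nat.exists_eq_succ_of_ne_zero hM
    have e1 : p (M s t) = p m * cs.simple s := by
      have := cs.wordProd_braidWord_eq s t
      simp only [braidWord] at this
      simp only [p]
      rw [this, ← M.symmetric s t, hm, alternatingWord_succ, cs.wordProd_concat]
    have e2 : w * cs.simple s = w * (p (M s t))⁻¹ * p m := by
      rw [e1, mul_inv_rev, cs.inv_simple]; group
    have h5 := cs.length_mul_le (w * (p (M s t))⁻¹) (p m)
    rw [← e2] at h5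
    have := hp m
    apply hw
    unfold IsRightDescent
    omega
  have hs : ¬ cs.IsRightDescent v s := by
    by_cases he : Even k <;> simp only [he, if_true, if_false] at ha hb <;> assumption
  have ht : ¬ cs.IsRightDescent v t := by
    by_cases he : Even k <;> simp only [he, if_true, if_false] at ha hb <;> assumption
  obtain ⟨a, b, ha0, hb0, e⟩ := D.exists_rep_alternatingWord_eq cs hst hkM
  rw [hvw, rep_mul_apply, e, map_add, map_smul, map_smul]
  exact D.posCone.add_mem
    (D.posCone.real_smul_mem_of_nnreal ha0 (IH _ (by omega) hs rfl))
    (D.posCone.real_smul_mem_of_nnreal hb0 (IH _ (by omega) ht rfl))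

theorem neg_rep_simpleRoot_mem_posCone {w : W} {s : B} (hw : cs.IsRightDescent w s) :
    -D.rep cs w (D.simpleRoot s) ∈ D.posCone := by
  have h := D.rep_simpleRoot_mem_posCone cs
    (cs.isRightDescent_iff_not_isRightDescent_mul.mp hw)
  rwa [rep_mul_apply, rep_simple_simpleRoot, map_neg] at h

end Action

/-! ### Signs, reducedness and faithfulness -/

section Roots

variable (D : BasedRootSystem M V) (cs : CoxeterSystem M W)

theorem mem_posRoots_iff {v : V} : v ∈ D.posRoots cs ↔ v ∈ D.roots cs ∧ v ∈ D.posCone := by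
  rw [mem_posCone_iff]; rfl

theorem rep_mem_roots (w : W) {v : V} (hv : v ∈ D.roots cs) : D.rep cs w v ∈ D.roots cs := by
  obtain ⟨x, i, rfl⟩ := hv
  exact ⟨w * x, i, (D.rep_mul_apply cs w x _).symm⟩

theorem neg_mem_roots {v : V} (hv : v ∈ D.roots cs) : -v ∈ D.roots cs := by
  obtain ⟨x, i, rfl⟩ := hv
  exact ⟨x * cs.simple i, i, by rw [rep_mul_apply, rep_simple_simpleRoot, map_neg]⟩

theorem simpleRoot_mem_posRoots (i : B) : D.simpleRoot i ∈ D.posRoots cs :=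
  (D.mem_posRoots_iff cs).mpr
    ⟨⟨1, i, (D.rep_one_apply cs _).symm⟩, D.simpleRoot_mem_posCone i⟩

theorem neg_mem_posRoots_of_notMem {v : V} (hv : v ∈ D.roots cs) (h : v ∉ D.posRoots cs) :
    -v ∈ D.posRoots cs := by
  rw [mem_posRoots_iff] at h ⊢
  refine ⟨D.neg_mem_roots cs hv, ?_⟩
  obtain ⟨w, i, rfl⟩ := hv
  by_cases hd : cs.IsRightDescent w i
  · exact D.neg_rep_simpleRoot_mem_posCone cs hd
  · exact absurd ⟨⟨w, i, rfl⟩, D.rep_simpleRoot_mem_posCone cs hd⟩ h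

theorem notMem_posRoots_of_neg_mem_posCone {v : V} (h : -v ∈ D.posCone) :
    v ∉ D.posRoots cs := fun hv => by
  have hv' := (D.mem_posRoots_iff cs).mp hv
  obtain ⟨⟨w, i, e⟩, hc⟩ := hv'
  have h0 := D.eq_zero_of_mem_posCone hc h
  rw [h0, eq_comm, LinearEquiv.map_eq_zero_iff] at e
  exact D.simpleRoot_ne_zero i e

theorem notMem_posRoots_of_neg_mem {v : V} (h : -v ∈ D.posRoots cs) : v ∉ D.posRoots cs :=
  D.notMem_posRoots_of_neg_mem_posCone cs ((D.mem_posRoots_iff cs).mp h).2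

/-- `W` acts faithfully on `V`. -/
theorem rep_injective : Function.Injective (D.rep cs) := by
  rw [injective_iff_map_eq_one]
  intro w hw
  by_contra h1
  obtain ⟨i, hi⟩ := cs.exists_rightDescent_of_ne_one h1
  have h := D.neg_rep_simpleRoot_mem_posCone cs hi
  rw [hw, LinearEquiv.coe_one, id] at h
  exact D.simpleRoot_ne_zero i (D.eq_zero_of_mem_posCone (D.simpleRoot_mem_posCone i) h)

theorem form_rep (w : W) (u v : V) : D.form (D.rep cs w u) (D.rep cs w v) = D.form u v := by
  induction w using cs.simple_induction_left with
  | one => simp only [rep_one_apply]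
  | mul_simple_left w i ih =>
    rw [rep_mul_apply, rep_mul_apply, ← ih]
    have h := (D.form_self_pos i).ne'
    simp only [rep_simple_apply, simpleCoroot_apply, map_sub, map_smul, LinearMap.sub_apply,
      LinearMap.smul_apply, smul_eq_mul, D.form_symm (D.rep cs w u) (D.simpleRoot i)]
    field_simp
    ring

/-- Simple roots of conjugate simple reflections have the same norm. -/
theorem form_self_eq_of_conj {w : W} {i j : B} (h : w * cs.simple j * w⁻¹ = cs.simple i) :
    D.form (D.simpleRoot i) (D.simpleRoot i) = D.form (D.simpleRoot j) (D.simpleRoot j) := by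
  classical
  -- A sign character of W detecting the norm of α_i: it respects the relations because odd `M k l`
  -- forces equal norms. Characters are constant on conjugates.
  let f : B → ℤˣ := fun k =>
    if D.form (D.simpleRoot k) (D.simpleRoot k) = D.form (D.simpleRoot i) (D.simpleRoot i)
    then -1 else 1
  have hf : M.IsLiftable f := fun k l => by
    rcases Nat.even_or_odd (M k l) with he | ho
    · exact Int.units_pow_eq_pow_mod_two (f k * f l) (M k l) |>.trans
        (by rw [Nat.even_iff.mp he, pow_zero])
    · have : f k = f l := by simp only [f, D.form_self_eq_of_odd k l ho]
      rw [this, Int.units_mul_self, one_pow]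
  have e := congrArg (cs.lift ⟨f, hf⟩) h
  rw [map_mul, map_mul, map_inv, mul_inv_cancel_comm, cs.lift_apply_simple hf,
    cs.lift_apply_simple hf] at e
  by_contra hne
  simp [f, Ne.symm hne] at e

/-- The root system is reduced. -/
theorem eq_one_of_smul_simpleRoot_mem_roots {c : ℝ} (hc : 0 ≤ c) {i : B}
    (h : c • D.simpleRoot i ∈ D.roots cs) : c = 1 := by
  obtain ⟨w, j, e⟩ := h
  have hf := D.form_rep cs w (D.simpleRoot j) (D.simpleRoot j)
  rw [← e] at hf
  simp only [map_smul, LinearMap.smul_apply, smul_eq_mul] at hf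
  have hi := D.form_self_pos i
  have hj := D.form_self_pos j
  have hc0 : c ≠ 0 := by rintro rfl; simp at hf; linarith
  -- Proportional roots define the same reflection, and the action is faithful; so the norms of α_i
  -- and α_j agree, giving c² = 1.
  have hw : w * cs.simple j * w⁻¹ = cs.simple i := by
    apply D.rep_injective cs
    ext v
    have h1 : D.form (D.simpleRoot j) (D.rep cs w⁻¹ v) = c * D.form (D.simpleRoot i) v := by
      rw [← D.form_rep cs w, rep_rep_inv, ← e, map_smul, LinearMap.smul_apply, smul_eq_mul]
    rw [rep_mul_apply, rep_mul_apply, rep_simple_apply, rep_simple_apply, map_sub, map_smul,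
      rep_rep_inv, ← e, simpleCoroot_apply, simpleCoroot_apply, h1, ← hf, smul_smul]
    congr 2
    field_simp
  rw [← D.form_self_eq_of_conj cs hw] at hf
  have : c * c = 1 := by
    apply mul_right_cancel₀ hi.ne'
    linarith
  nlinarith

/-- A simple reflection permutes the positive roots other than its own simple root. -/
theorem rep_simple_mem_posRoots {i : B} {v : V} (hv : v ∈ D.posRoots cs)
    (hi : v ≠ D.simpleRoot i) : D.rep cs (cs.simple i) v ∈ D.posRoots cs := by
  by_contra h
  have hn := D.neg_mem_posRoots_of_notMem cs (D.rep_mem_roots cs _ hv.1) h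
  obtain ⟨hr, c, hc, e⟩ := hv
  obtain ⟨-, d, hd, e'⟩ := hn
  -- A multiple of α_i is the sum of v and -s_i(v), both in the cone; extremality then puts v itself
  -- on the ray of α_i.
  have hk : D.simpleCoroot i v • D.simpleRoot i = (c + d).sum fun i a => a • D.simpleRoot i := by
    rw [sum_add, ← e, ← e', rep_simple_apply]; module
  have hci : c = Finsupp.single i (c i) := by
    ext j
    by_cases hj : j = i
    · rw [hj, Finsupp.single_eq_same]
    · have := D.coeff_eq_zero_of_smul_eq_sum (fun k => add_nonneg (hc k) (hd k)) hk hj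
      rw [Finsupp.add_apply] at this
      rw [Finsupp.single_eq_of_ne hj]
      have := hc j
      have := hd j
      linarith
  rw [hci, sum_single] at e
  rw [e] at hr hi
  apply hi
  rw [D.eq_one_of_smul_simpleRoot_mem_roots cs (hc i) hr, one_smul]

end Roots

/-! ### Inversion sets, length and the weak order -/

section Inversions

variable (D : BasedRootSystem M V) (cs : CoxeterSystem M W)

theorem mem_inversions_iff {z : W} {v : V} :
    v ∈ D.inversions cs z ↔ v ∈ D.posRoots cs ∧ D.rep cs z⁻¹ v ∉ D.posRoots cs := by
  constructor
  · rintro ⟨hv, u, hu, rfl⟩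
    refine ⟨hv, ?_⟩
    rw [rep_inv_rep]
    exact D.notMem_posRoots_of_neg_mem cs hu
  · rintro ⟨hv, h⟩
    exact ⟨hv, _, D.neg_mem_posRoots_of_notMem cs (D.rep_mem_roots cs _ hv.1) h,
      D.rep_rep_inv cs z v⟩

theorem inversions_subset_posRoots (z : W) : D.inversions cs z ⊆ D.posRoots cs := fun _ h => h.1

theorem inversions_one : D.inversions cs 1 = ∅ := by
  ext v
  rw [mem_inversions_iff, inv_one, rep_one_apply]
  simp

theorem inversions_simple (i : B) : D.inversions cs (cs.simple i) = {D.simpleRoot i} := by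
  ext v
  rw [mem_inversions_iff, cs.inv_simple, Set.mem_singleton_iff]
  constructor
  · rintro ⟨hv, h⟩
    by_contra hne
    exact h (D.rep_simple_mem_posRoots cs hv hne)
  · rintro rfl
    refine ⟨D.simpleRoot_mem_posRoots cs i, ?_⟩
    rw [rep_simple_simpleRoot]
    apply D.notMem_posRoots_of_neg_mem cs
    rw [neg_neg]
    exact D.simpleRoot_mem_posRoots cs i

theorem simpleRoot_mem_inversions_iff {z : W} {i : B} :
    D.simpleRoot i ∈ D.inversions cs z ↔ cs.IsLeftDescent z i := by
  rw [mem_inversions_iff, ← cs.isRightDescent_inv_iff]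
  constructor
  · rintro ⟨-, h⟩
    by_contra hd
    exact h ((D.mem_posRoots_iff cs).mpr ⟨⟨_, i, rfl⟩, D.rep_simpleRoot_mem_posCone cs hd⟩)
  · intro h
    exact ⟨D.simpleRoot_mem_posRoots cs i,
      D.notMem_posRoots_of_neg_mem_posCone cs (D.neg_rep_simpleRoot_mem_posCone cs h)⟩

theorem exists_simpleRoot_mem_inversions {z : W} (hz : z ≠ 1) :
    ∃ i, D.simpleRoot i ∈ D.inversions cs z := by
  simp only [simpleRoot_mem_inversions_iff]
  exact cs.exists_leftDescent_of_ne_one hz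

theorem inversions_mul_subset (z x : W) :
    D.inversions cs (z * x) ⊆ D.inversions cs z ∪ D.rep cs z '' D.inversions cs x := by
  intro v hv
  rw [mem_inversions_iff, mul_inv_rev, rep_mul_apply] at hv
  by_cases h : D.rep cs z⁻¹ v ∈ D.posRoots cs
  · exact Or.inr ⟨_, (D.mem_inversions_iff cs).mpr ⟨h, hv.2⟩, D.rep_rep_inv cs z v⟩
  · exact Or.inl ((D.mem_inversions_iff cs).mpr ⟨hv.1, h⟩)

theorem disjoint_inversions_image (z x : W) :
    Disjoint (D.inversions cs z) (D.rep cs z '' D.inversions cs x) := by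
  rw [Set.disjoint_left]
  rintro _ h ⟨u, hu, rfl⟩
  rw [mem_inversions_iff, rep_inv_rep] at h
  exact h.2 hu.1

/-- A root v of Φ_x with z(v) negative is the same thing as a root -z(v) of Φ_z missing from Φ_{zx}.
-/
theorem inversions_subset_mul_iff {z x : W} :
    D.inversions cs z ⊆ D.inversions cs (z * x) ↔
      D.rep cs z '' D.inversions cs x ⊆ D.posRoots cs := by
  constructor
  · rintro h _ ⟨v, hv, rfl⟩
    by_contra hn
    have hn' := D.neg_mem_posRoots_of_notMem cs (D.rep_mem_roots cs _ hv.1.1) hn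
    have h1 : -D.rep cs z v ∈ D.inversions cs z := by
      rw [mem_inversions_iff, map_neg, rep_inv_rep]
      refine ⟨hn', D.notMem_posRoots_of_neg_mem cs ?_⟩
      rw [neg_neg]; exact hv.1
    have h2 := h h1
    rw [mem_inversions_iff, mul_inv_rev, rep_mul_apply, map_neg, rep_inv_rep, map_neg] at h2
    rw [mem_inversions_iff] at hv
    exact h2.2 (D.neg_mem_posRoots_of_notMem cs (D.rep_mem_roots cs _ hv.1.1) hv.2)
  · intro h v hv
    rw [mem_inversions_iff] at hv
    have hn := D.neg_mem_posRoots_of_notMem cs (D.rep_mem_roots cs _ hv.1.1) hv.2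
    rw [mem_inversions_iff, mul_inv_rev, rep_mul_apply]
    refine ⟨hv.1, fun h2 => ?_⟩
    have h3 : -D.rep cs z⁻¹ v ∈ D.inversions cs x := by
      rw [mem_inversions_iff, map_neg]
      refine ⟨hn, D.notMem_posRoots_of_neg_mem cs ?_⟩
      rw [neg_neg]; exact h2
    have h4 := h ⟨_, h3, rfl⟩
    rw [map_neg, rep_rep_inv] at h4
    exact D.notMem_posRoots_of_neg_mem cs h4 hv.1

theorem image_subset_inversions_mul {z x : W}
    (h : D.rep cs z '' D.inversions cs x ⊆ D.posRoots cs) :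
    D.rep cs z '' D.inversions cs x ⊆ D.inversions cs (z * x) := by
  rintro _ ⟨v, hv, rfl⟩
  rw [mem_inversions_iff, mul_inv_rev, rep_mul_apply, rep_inv_rep]
  exact ⟨h ⟨v, hv, rfl⟩, ((D.mem_inversions_iff cs).mp hv).2⟩

theorem inversions_mul {z x : W} (h : D.rep cs z '' D.inversions cs x ⊆ D.posRoots cs) :
    D.inversions cs (z * x) = D.inversions cs z ∪ D.rep cs z '' D.inversions cs x :=
  (D.inversions_mul_subset cs z x).antisymm <|
    Set.union_subset ((D.inversions_subset_mul_iff cs).mpr h) (D.image_subset_inversions_mul cs h)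

theorem image_simple_subset_posRoots {i : B} {x : W} (h : D.simpleRoot i ∉ D.inversions cs x) :
    D.rep cs (cs.simple i) '' D.inversions cs x ⊆ D.posRoots cs := by
  rintro _ ⟨v, hv, rfl⟩
  exact D.rep_simple_mem_posRoots cs hv.1 (by rintro rfl; exact h hv)

theorem inversions_simple_mul {i : B} {x : W} (h : D.simpleRoot i ∉ D.inversions cs x) :
    D.inversions cs (cs.simple i * x) =
      {D.simpleRoot i} ∪ D.rep cs (cs.simple i) '' D.inversions cs x := by
  rw [D.inversions_mul cs (D.image_simple_subset_posRoots cs h), inversions_simple]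

/-- Stripping a left descent i removes exactly one root: Φ_z is the disjoint union of {α_i} and
s_i(Φ_{s_i z}). -/
theorem encard_inversions (z : W) : (D.inversions cs z).encard = cs.length z := by
  induction hn : cs.length z generalizing z with
  | zero =>
    rw [cs.length_eq_zero_iff] at hn
    rw [hn, inversions_one]; simp
  | succ n ih =>
    obtain ⟨i, hi⟩ := cs.exists_leftDescent_of_ne_one (w := z) (by rintro rfl; simp at hn)
    have h1 := cs.isLeftDescent_iff.mp hi
    have h2 := ih (cs.simple i * z) (by omega)
    have h3 : D.simpleRoot i ∉ D.inversions cs (cs.simple i * z) := by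
      rw [simpleRoot_mem_inversions_iff]
      exact cs.isLeftDescent_iff_not_isLeftDescent_mul.mp hi
    have h4 := D.inversions_simple_mul cs h3
    rw [cs.simple_mul_simple_cancel_left, ← D.inversions_simple cs] at h4
    rw [h4, Set.encard_union_eq (D.disjoint_inversions_image cs _ _), inversions_simple,
      Set.encard_singleton, (D.rep cs _).injective.encard_image, h2]
    push_cast
    ring

theorem finite_inversions (z : W) : (D.inversions cs z).Finite := by
  rw [← Set.encard_ne_top_iff, encard_inversions]
  exact ENat.natCast_ne_top _

theorem length_le_of_subset {x y : W} (h : D.inversions cs x ⊆ D.inversions cs y) :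
    cs.length x ≤ cs.length y := by
  have := Set.encard_le_encard h
  rw [encard_inversions, encard_inversions] at this
  exact_mod_cast this

theorem inversions_eq_of_subset_of_length_le {x y : W} (h : D.inversions cs x ⊆ D.inversions cs y)
    (hl : cs.length y ≤ cs.length x) : D.inversions cs x = D.inversions cs y := by
  apply (D.finite_inversions cs x).eq_of_subset_of_encard_le h
  rw [encard_inversions, encard_inversions]
  exact_mod_cast hl

theorem encard_union_image (z x : W) :
    (D.inversions cs z ∪ D.rep cs z '' D.inversions cs x).encard =
      (cs.length z + cs.length x : ℕ) := by
  rw [Set.encard_union_eq (D.disjoint_inversions_image cs z x),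
    (D.rep cs z).injective.encard_image, encard_inversions, encard_inversions]
  push_cast; rfl

/-- Φ_{zx} always lies in Φ_z ⊔ z(Φ_x), which has l(z) + l(x) elements, so additivity of length
means equality. -/
theorem length_mul_eq_iff {z x : W} :
    cs.length (z * x) = cs.length z + cs.length x ↔
      D.rep cs z '' D.inversions cs x ⊆ D.posRoots cs := by
  constructor
  · intro h
    have h1 := (D.finite_inversions cs (z * x)).eq_of_subset_of_encard_le
      (D.inversions_mul_subset cs z x)
      (by rw [encard_union_image, encard_inversions, h])
    exact fun v hv => D.inversions_subset_posRoots cs (z * x) (h1.symm ▸ Or.inr hv)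
  · intro h
    have h1 := congrArg Set.encard (D.inversions_mul cs h)
    rw [encard_union_image, encard_inversions] at h1
    exact_mod_cast h1

/-- The weak order is inclusion of inversion sets. -/
theorem weakOrder_le_iff {x y : W} :
    cs.weakOrder.le x y ↔ D.inversions cs x ⊆ D.inversions cs y := by
  change cs.length y = cs.length x + cs.length (x⁻¹ * y) ↔ _
  have h1 := D.length_mul_eq_iff cs (z := x) (x := x⁻¹ * y)
  have h2 := D.inversions_subset_mul_iff cs (z := x) (x := x⁻¹ * y)
  rw [mul_inv_cancel_left] at h1 h2
  rw [h1, h2]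

theorem inversions_injective : Function.Injective (D.inversions cs) := fun x y h =>
  cs.weakOrder.le_antisymm x y ((D.weakOrder_le_iff cs).mpr h.subset)
    ((D.weakOrder_le_iff cs).mpr h.symm.subset)

/-- Inversion sets are closed under taking roots in convex cones. -/
theorem mem_inversions_of_mem_span {A : Set V} {z : W} (hA : A ⊆ D.inversions cs z) {v : V}
    (hv : v ∈ D.roots cs) (hs : v ∈ Submodule.span NNReal A) : v ∈ D.inversions cs z := by
  have h1 : Submodule.span NNReal A ≤ D.posCone :=
    Submodule.span_le.mpr fun u hu => ((D.mem_posRoots_iff cs).mp (hA hu).1).2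
  rw [mem_inversions_iff, mem_posRoots_iff]
  refine ⟨⟨hv, h1 hs⟩, ?_⟩
  apply D.notMem_posRoots_of_neg_mem_posCone cs
  clear hv
  induction hs using Submodule.span_induction with
  | mem u hu =>
    have h2 := (D.mem_inversions_iff cs).mp (hA hu)
    exact ((D.mem_posRoots_iff cs).mp
      (D.neg_mem_posRoots_of_notMem cs (D.rep_mem_roots cs _ h2.1.1) h2.2)).2
  | zero => simp
  | add u u' _ _ h h' => rw [map_add, neg_add]; exact add_mem h h'
  | smul a u _ h =>
    have : D.rep cs z⁻¹ (a • u) = a • D.rep cs z⁻¹ u := (D.rep cs z⁻¹).map_smul (a : ℝ) u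
    rw [this, ← smul_neg]
    exact D.posCone.smul_mem a h

theorem inversions_subset_of_subset_span {A : Set V} {x z : W} (hA : A ⊆ D.inversions cs z)
    (hx : D.inversions cs x ⊆ Submodule.span NNReal A) :
    D.inversions cs x ⊆ D.inversions cs z := fun _ hv =>
  D.mem_inversions_of_mem_span cs hA hv.1.1 (hx hv)

theorem image_span_subset (w : W) {A C : Set V} (h : C ⊆ Submodule.span NNReal A) :
    D.rep cs w '' C ⊆ Submodule.span NNReal (D.rep cs w '' A) := by
  have := Submodule.map_span ((D.rep cs w).toLinearMap.restrictScalars NNReal) A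
  rintro _ ⟨v, hv, rfl⟩
  exact this.le ⟨v, h hv, rfl⟩

end Inversions

/-! ### Joins and meets via convex cones -/

section Joins

variable (D : BasedRootSystem M V) (cs : CoxeterSystem M W)

/-- The inversion set of `j` contains `A` and lies in the convex cone spanned by `A`. -/
def IsConicJoin (A : Set V) (j : W) : Prop :=
  A ⊆ D.inversions cs j ∧ D.inversions cs j ⊆ Submodule.span NNReal A

theorem exists_length_maximal {E : Set W} (hE : E.Nonempty) {u : W}
    (hu : ∀ w ∈ E, D.inversions cs w ⊆ D.inversions cs u) :
    ∃ w ∈ E, ∀ w' ∈ E, cs.length w' ≤ cs.length w := by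
  have hfin : (cs.length '' E).Finite :=
    (Set.finite_Iic (cs.length u)).subset (by
      rintro _ ⟨w, hw, rfl⟩
      exact D.length_le_of_subset cs (hu w hw))
  obtain ⟨_, ⟨⟨w, hw, rfl⟩, hmax⟩⟩ := hfin.exists_maximal (hE.image _)
  exact ⟨w, hw, fun w' hw' => le_of_not_gt fun h => h.not_ge (hmax ⟨w', hw', rfl⟩ h.le)⟩

/-- A simple reflection maps positive roots in the cone of two simple roots into that cone. -/
theorem rep_simple_mem_span_pair {s t : B} (hst : s ≠ t) {v : V} (hv : v ∈ D.posRoots cs)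
    (hs : v ≠ D.simpleRoot s)
    (h : v ∈ Submodule.span NNReal {D.simpleRoot s, D.simpleRoot t}) :
    D.rep cs (cs.simple s) v ∈ Submodule.span NNReal {D.simpleRoot s, D.simpleRoot t} := by
  have hp := ((D.mem_posRoots_iff cs).mp (D.rep_simple_mem_posRoots cs hv hs)).2
  obtain ⟨a, b, e⟩ := Submodule.mem_span_pair.mp h
  have e1 : D.rep cs (cs.simple s) v =
      ((a : ℝ) - D.simpleCoroot s v) • D.simpleRoot s + (b : ℝ) • D.simpleRoot t := by
    rw [rep_simple_apply]
    nth_rw 1 [← e]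
    simp only [NNReal.smul_def]
    module
  rw [e1] at hp ⊢
  have ha := D.nonneg_of_add_smul_mem_posCone hst hp
  exact add_mem
    (Submodule.real_smul_mem_of_nnreal _ ha (Submodule.subset_span (Set.mem_insert _ _)))
    (Submodule.real_smul_mem_of_nnreal _ b.2 (Submodule.subset_span (by simp)))

theorem mem_inversions_of_length_maximal {s t : B} (hst : s ≠ t) {w : W}
    (hw : D.inversions cs w ⊆ Submodule.span NNReal {D.simpleRoot s, D.simpleRoot t})
    (hmax : ∀ w', D.inversions cs w' ⊆ Submodule.span NNReal {D.simpleRoot s, D.simpleRoot t} →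
      cs.length w' ≤ cs.length w) : D.simpleRoot s ∈ D.inversions cs w := by
  by_contra h
  have h1 := hmax (cs.simple s * w) (by
    rw [D.inversions_simple_mul cs h]
    apply Set.union_subset
    · exact Set.singleton_subset_iff.mpr (Submodule.subset_span (Set.mem_insert _ _))
    · rintro _ ⟨v, hv, rfl⟩
      exact D.rep_simple_mem_span_pair cs hst hv.1 (by rintro rfl; exact h hv) (hw hv))
  rw [simpleRoot_mem_inversions_iff, cs.not_isLeftDescent_iff] at h
  omega

/-- Take w of maximal length with Φ_w in the cone of α_s and α_t; the bound u limits the length. If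
α_s were not in Φ_w, then sw would be longer with Φ_{sw} still in the cone; likewise for t. -/
theorem exists_isConicJoin_simpleRoots {s t : B} (hst : s ≠ t) {u : W}
    (hs : D.simpleRoot s ∈ D.inversions cs u) (ht : D.simpleRoot t ∈ D.inversions cs u) :
    ∃ w, D.IsConicJoin cs {D.simpleRoot s, D.simpleRoot t} w := by
  obtain ⟨w, hw, hmax⟩ := D.exists_length_maximal cs (u := u)
    (E := {w | D.inversions cs w ⊆ Submodule.span NNReal {D.simpleRoot s, D.simpleRoot t}})
    ⟨1, by simp [inversions_one]⟩
    (fun w hw => D.inversions_subset_of_subset_span cs (Set.pair_subset hs ht) hw)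
  refine ⟨w, Set.pair_subset ?_ ?_, hw⟩
  · exact D.mem_inversions_of_length_maximal cs hst hw hmax
  · rw [Set.pair_comm] at hw
    refine D.mem_inversions_of_length_maximal cs hst.symm hw fun w' hw' => hmax w' ?_
    rwa [Set.mem_ofPred_eq, Set.pair_comm]

theorem simpleRoot_notMem_inversions_simple_mul {s : B} {z : W}
    (h : D.simpleRoot s ∈ D.inversions cs z) :
    D.simpleRoot s ∉ D.inversions cs (cs.simple s * z) := by
  rw [simpleRoot_mem_inversions_iff] at h ⊢
  exact cs.isLeftDescent_iff_not_isLeftDescent_mul.mp h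

theorem inversions_eq_of_simpleRoot_mem {s : B} {z : W} (h : D.simpleRoot s ∈ D.inversions cs z) :
    D.inversions cs z =
      {D.simpleRoot s} ∪ D.rep cs (cs.simple s) '' D.inversions cs (cs.simple s * z) := by
  have := D.inversions_simple_mul cs (D.simpleRoot_notMem_inversions_simple_mul cs h)
  rwa [cs.simple_mul_simple_cancel_left] at this

theorem inversions_simple_mul_subset {s : B} {x y : W} (hx : D.simpleRoot s ∈ D.inversions cs x)
    (hxy : D.inversions cs x ⊆ D.inversions cs y) :
    D.inversions cs (cs.simple s * x) ⊆ D.inversions cs (cs.simple s * y) := by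
  intro v hv
  have h1 : D.rep cs (cs.simple s) v ∈ D.inversions cs y := hxy (by
    rw [D.inversions_eq_of_simpleRoot_mem cs hx]; exact Or.inr ⟨v, hv, rfl⟩)
  rw [D.inversions_eq_of_simpleRoot_mem cs (hxy hx)] at h1
  rcases h1 with h1 | ⟨u, hu, e⟩
  · exfalso
    have h2 := congrArg (D.rep cs (cs.simple s)) (Set.mem_singleton_iff.mp h1)
    rw [rep_simple_rep_simple, rep_simple_simpleRoot] at h2
    refine D.notMem_posRoots_of_neg_mem cs ?_ hv.1
    rw [h2, neg_neg]
    exact D.simpleRoot_mem_posRoots cs s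
  · rwa [← (D.rep cs (cs.simple s)).injective e]

/-- Two elements with a common upper bound have a join, whose inversion set lies in the cone
spanned by the two inversion sets. -/
theorem exists_isConicJoin_pair {u x y : W} (hx : D.inversions cs x ⊆ D.inversions cs u)
    (hy : D.inversions cs y ⊆ D.inversions cs u) :
    ∃ j, D.IsConicJoin cs (D.inversions cs x ∪ D.inversions cs y) j := by
  induction hn : cs.length u using Nat.strong_induction_on generalizing u x y with
  | _ n IH =>
  subst hn
  -- With a common left descent s, strip s from x, y and u, join below the shorter bound su, and put
  -- s back.
  have common : ∀ {s : B} {x y : W}, D.simpleRoot s ∈ D.inversions cs x →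
      D.simpleRoot s ∈ D.inversions cs y → D.inversions cs x ⊆ D.inversions cs u →
      D.inversions cs y ⊆ D.inversions cs u →
      ∃ j, D.IsConicJoin cs (D.inversions cs x ∪ D.inversions cs y) j := by
    intro s x y hsx hsy hx hy
    have hl := cs.isLeftDescent_iff.mp ((D.simpleRoot_mem_inversions_iff cs).mp (hx hsx))
    have hx1 := D.inversions_simple_mul_subset cs hsx hx
    have hy1 := D.inversions_simple_mul_subset cs hsy hy
    obtain ⟨j, hj1, hj2⟩ := IH _ (by omega) hx1 hy1 rfl
    have hju := D.inversions_subset_of_subset_span cs (Set.union_subset hx1 hy1) hj2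
    have hsj : D.simpleRoot s ∉ D.inversions cs j := fun h =>
      D.simpleRoot_notMem_inversions_simple_mul cs (hx hsx) (hju h)
    refine ⟨cs.simple s * j, ?_, ?_⟩
    · rw [D.inversions_simple_mul cs hsj, D.inversions_eq_of_simpleRoot_mem cs hsx,
        D.inversions_eq_of_simpleRoot_mem cs hsy, ← Set.union_union_distrib_left, ← Set.image_union]
      exact Set.union_subset_union_right _ (Set.image_mono hj1)
    · rw [D.inversions_simple_mul cs hsj]
      apply Set.union_subset
      · exact Set.singleton_subset_iff.mpr (Submodule.subset_span (Or.inl hsx))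
      · refine (D.image_span_subset cs _ hj2).trans (Submodule.span_mono ?_)
        rw [D.inversions_eq_of_simpleRoot_mem cs hsx, D.inversions_eq_of_simpleRoot_mem cs hsy,
          ← Set.union_union_distrib_left, ← Set.image_union]
        exact Set.subset_union_right
  by_cases hx1 : x = 1
  · refine ⟨y, ?_, ?_⟩ <;> rw [hx1, inversions_one, Set.empty_union]
    exact Submodule.subset_span
  by_cases hy1 : y = 1
  · refine ⟨x, ?_, ?_⟩ <;> rw [hy1, inversions_one, Set.union_empty]
    exact Submodule.subset_span
  obtain ⟨s, hs⟩ := D.exists_simpleRoot_mem_inversions cs hx1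
  obtain ⟨t, ht⟩ := D.exists_simpleRoot_mem_inversions cs hy1
  by_cases hst : s = t
  · subst hst
    exact common hs ht hx hy
  -- Distinct descents are linked through w = s ∨ t: x and w share s, w and y share t, and the joins
  -- a = x ∨ w and b = w ∨ y share s. Each join stays below u, so `common` applies three times.
  obtain ⟨w, hw1, hw2⟩ := D.exists_isConicJoin_simpleRoots cs hst (hx hs) (hy ht)
  have hwu := D.inversions_subset_of_subset_span cs (Set.pair_subset (hx hs) (hy ht)) hw2
  obtain ⟨a, ha1, ha2⟩ := common hs (hw1 (by simp)) hx hwu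
  obtain ⟨b, hb1, hb2⟩ := common (hw1 (by simp)) ht hwu hy
  have hau := D.inversions_subset_of_subset_span cs (Set.union_subset hx hwu) ha2
  have hbu := D.inversions_subset_of_subset_span cs (Set.union_subset hwu hy) hb2
  obtain ⟨j, hj1, hj2⟩ := common (ha1 (Or.inl hs)) (hb1 (Or.inl (hw1 (by simp)))) hau hbu
  refine ⟨j, ?_, ?_⟩
  · exact Set.union_subset
      (Set.subset_union_left.trans (ha1.trans (Set.subset_union_left.trans hj1)))
      (Set.subset_union_right.trans (hb1.trans (Set.subset_union_right.trans hj1)))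
  · let C := Submodule.span NNReal (D.inversions cs x ∪ D.inversions cs y)
    have hxC : D.inversions cs x ⊆ C := Set.subset_union_left.trans Submodule.subset_span
    have hyC : D.inversions cs y ⊆ C := Set.subset_union_right.trans Submodule.subset_span
    have hwC : D.inversions cs w ⊆ C :=
      hw2.trans (Submodule.span_le.mpr (Set.pair_subset (hxC hs) (hyC ht)))
    exact hj2.trans (Submodule.span_le.mpr (Set.union_subset
      (ha2.trans (Submodule.span_le.mpr (Set.union_subset hxC hwC)))
      (hb2.trans (Submodule.span_le.mpr (Set.union_subset hwC hyC)))))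

/-- Bounded subsets have a join, whose inversion set lies in the cone spanned by the union of the
inversion sets. -/
theorem exists_isConicJoin {X : Set W} {u : W}
    (hu : ∀ y ∈ X, D.inversions cs y ⊆ D.inversions cs u) :
    ∃ j, D.IsConicJoin cs (⋃ y ∈ X, D.inversions cs y) j := by
  set A := ⋃ y ∈ X, D.inversions cs y with hA
  have hAu : A ⊆ D.inversions cs u := Set.iUnion₂_subset hu
  obtain ⟨j, hj, hmax⟩ := D.exists_length_maximal cs (u := u)
    (E := {w | D.inversions cs w ⊆ Submodule.span NNReal A}) ⟨1, by simp [inversions_one]⟩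
    (fun w hw => D.inversions_subset_of_subset_span cs hAu hw)
  refine ⟨j, Set.iUnion₂_subset fun y hy => ?_, hj⟩
  have hyA : D.inversions cs y ⊆ A := Set.subset_biUnion_of_mem hy
  -- Joining y to j stays in the cone of A, so maximality of l(j) shows that nothing is gained and y
  -- ≤ j.
  obtain ⟨k, hk1, hk2⟩ := D.exists_isConicJoin_pair cs
    (D.inversions_subset_of_subset_span cs hAu hj) (hu y hy)
  have hkA : D.inversions cs k ⊆ Submodule.span NNReal A :=
    hk2.trans (Submodule.span_le.mpr (Set.union_subset hj (hyA.trans Submodule.subset_span)))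
  have e := D.inversions_eq_of_subset_of_length_le cs (Set.subset_union_left.trans hk1)
    (hmax k hkA)
  rw [e]
  exact Set.subset_union_right.trans hk1

theorem IsConicJoin.subset_iff {D : BasedRootSystem M V} {cs : CoxeterSystem M W} {A : Set V}
    {j z : W} (hj : D.IsConicJoin cs A j) :
    D.inversions cs j ⊆ D.inversions cs z ↔ A ⊆ D.inversions cs z :=
  ⟨hj.1.trans, fun h => D.inversions_subset_of_subset_span cs h hj.2⟩

theorem IsConicJoin.isLUB {D : BasedRootSystem M V} {cs : CoxeterSystem M W} {X : Set W} {j : W}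
    (hj : D.IsConicJoin cs (⋃ y ∈ X, D.inversions cs y) j) :
    letI : PartialOrder W := cs.weakOrder
    IsLUB X j := by
  let : PartialOrder W := cs.weakOrder
  have hle : ∀ x y : W, x ≤ y ↔ D.inversions cs x ⊆ D.inversions cs y :=
    fun x y => D.weakOrder_le_iff cs
  refine ⟨fun y hy => (hle _ _).mpr ((Set.subset_biUnion_of_mem hy).trans hj.1), fun z hz => ?_⟩
  rw [hle, hj.subset_iff]
  exact Set.iUnion₂_subset fun y hy => (hle _ _).mp (hz hy)

/-- Nonempty sets have meets in the weak order. -/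
theorem exists_meet {Y : Set W} (hY : Y.Nonempty) :
    ∃ m, ∀ x, D.inversions cs x ⊆ D.inversions cs m ↔
      ∀ y ∈ Y, D.inversions cs x ⊆ D.inversions cs y := by
  obtain ⟨y₀, hy₀⟩ := hY
  -- The meet is the join of all lower bounds, a set bounded by y₀.
  obtain ⟨m, hm⟩ := D.exists_isConicJoin cs (u := y₀)
    (X := {x | ∀ y ∈ Y, D.inversions cs x ⊆ D.inversions cs y}) (fun x hx => hx y₀ hy₀)
  refine ⟨m, fun x => ⟨fun h y hy => h.trans ?_, fun h => ?_⟩⟩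
  · exact hm.subset_iff.mpr (Set.iUnion₂_subset fun x hx => hx y hy)
  · exact (Set.subset_iUnion₂_of_subset x h subset_rfl).trans hm.1

end Joins

/-! ### The relation R, and its stability under meets and joins -/

section Relation

variable (D : BasedRootSystem M V) (cs : CoxeterSystem M W)

theorem image_rep_mul (x y : W) (A : Set V) :
    D.rep cs (x * y) '' A = D.rep cs x '' (D.rep cs y '' A) := by
  rw [Set.image_image]
  exact Set.image_congr fun v _ => D.rep_mul_apply cs x y v

theorem image_rep_one (A : Set V) : D.rep cs 1 '' A = A := by
  rw [Set.image_congr fun v _ => D.rep_one_apply cs v, Set.image_id']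

theorem R_one_right (x : W) : D.R cs x 1 := D.image_rep_one cs _

theorem R_one_left (z : W) : D.R cs 1 z := by
  rw [R, inversions_one, Set.image_empty]

variable {D cs}

theorem R.mul {x z z' : W} (h : D.R cs x z) (h' : D.R cs x z') : D.R cs x (z * z') := by
  rw [R] at *
  rw [image_rep_mul, h', h]

theorem R.inv {x z : W} (h : D.R cs x z) : D.R cs x z⁻¹ := by
  rw [R] at *
  nth_rw 1 [← h]
  rw [← image_rep_mul, inv_mul_cancel, image_rep_one]

theorem R.image_subset_posRoots {x z : W} (h : D.R cs x z) :
    D.rep cs z '' D.inversions cs x ⊆ D.posRoots cs := by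
  rw [R] at h
  rw [h]
  exact D.inversions_subset_posRoots cs x

variable (D cs)

theorem R_iff_inversions_mul {x z : W} :
    D.R cs x z ↔ D.inversions cs (z * x) = D.inversions cs z ∪ D.inversions cs x ∧
      Disjoint (D.inversions cs z) (D.inversions cs x) := by
  constructor
  · intro h
    have h1 := D.inversions_mul cs h.image_subset_posRoots
    have h2 := D.disjoint_inversions_image cs z x
    rw [R] at h
    rw [h] at h1 h2
    exact ⟨h1, h2⟩
  · rintro ⟨h1, h2⟩
    have h3 := (D.inversions_subset_mul_iff cs).mp (h1 ▸ Set.subset_union_left)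
    have h4 := D.inversions_mul cs h3
    have h5 := D.disjoint_inversions_image cs z x
    rw [h1] at h4
    rw [R]
    exact (h5.symm.subset_right_of_subset_union (Set.subset_union_right.trans h4.symm.subset)).antisymm
      (h2.symm.subset_right_of_subset_union (Set.subset_union_right.trans h4.subset))

/-- The meet of a set of elements related to `z` is related to `z`. -/
theorem R_meet {Y : Set W} (hY : Y.Nonempty) {z m : W} (hR : ∀ y ∈ Y, D.R cs y z)
    (hm : ∀ x, D.inversions cs x ⊆ D.inversions cs m ↔
      ∀ y ∈ Y, D.inversions cs x ⊆ D.inversions cs y) : D.R cs m z := by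
  obtain ⟨y₀, hy₀⟩ := hY
  have hmy := (hm m).mp subset_rfl
  have hzy : ∀ y ∈ Y, D.inversions cs z ∪ D.inversions cs m ⊆ D.inversions cs (z * y) :=
    fun y hy => by
      rw [((D.R_iff_inversions_mul cs).mp (hR y hy)).1]
      exact Set.union_subset_union_right _ (hmy y hy)
  obtain ⟨j, hj⟩ := D.exists_isConicJoin_pair cs (u := z * y₀)
    (Set.subset_union_left.trans (hzy y₀ hy₀)) (Set.subset_union_right.trans (hzy y₀ hy₀))
  obtain ⟨k, rfl⟩ : ∃ k, j = z * k := ⟨z⁻¹ * j, by group⟩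
  have hk := (D.inversions_subset_mul_iff cs).mp (Set.subset_union_left.trans hj.1)
  -- Since zk ≤ zy with both products length-additive, cancelling Φ_z and then z gives k ≤ y.
  have hkm : D.inversions cs k ⊆ D.inversions cs m := (hm k).mpr fun y hy => by
    have h1 := hj.subset_iff.mpr (hzy y hy)
    rw [D.inversions_mul cs hk, D.inversions_mul cs (hR y hy).image_subset_posRoots] at h1
    have h3 : D.rep cs z '' D.inversions cs k ⊆ D.rep cs z '' D.inversions cs y :=
      (D.disjoint_inversions_image cs z k).symm.subset_right_of_subset_union
        (Set.subset_union_right.trans h1)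
    exact (Set.image_subset_image_iff (D.rep cs z).injective).mp h3
  have hd : Disjoint (D.inversions cs z) (D.inversions cs m) :=
    ((D.R_iff_inversions_mul cs).mp (hR y₀ hy₀)).2.mono_right (hmy y₀ hy₀)
  have hl := (D.length_mul_eq_iff cs).mpr hk
  have hlk := D.length_le_of_subset cs hkm
  have hc : (D.inversions cs z ∪ D.inversions cs m).encard =
      (cs.length z + cs.length m : ℕ) := by
    rw [Set.encard_union_eq hd, encard_inversions, encard_inversions]; push_cast; rfl
  -- Φ_z and Φ_m are disjoint subsets of Φ_{zk}, so l(m) ≤ l(k); with k ≤ m this forces k = m.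
  have hle : cs.length z + cs.length m ≤ cs.length (z * k) := by
    have := Set.encard_le_encard hj.1
    rw [hc, encard_inversions] at this
    exact_mod_cast this
  have e := ((D.finite_inversions cs z).union (D.finite_inversions cs m)).eq_of_subset_of_encard_le
    hj.1 (by rw [hc, encard_inversions]; exact_mod_cast (by omega))
  have hkm' : k = m := D.inversions_injective cs
    (D.inversions_eq_of_subset_of_length_le cs hkm (by omega))
  rw [hkm'] at e
  exact (D.R_iff_inversions_mul cs).mpr ⟨e.symm, hd⟩

/-- The join of a set of elements related to `z` is related to `z`. -/
theorem R_join {X : Set W} {z j : W} (hR : ∀ y ∈ X, D.R cs y z)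
    (hj : D.IsConicJoin cs (⋃ y ∈ X, D.inversions cs y) j) : D.R cs j z := by
  -- Stated for all z so that it also applies to z⁻¹, which yields the reverse inclusion.
  have key : ∀ z : W, (∀ y ∈ X, D.R cs y z) →
      D.rep cs z '' D.inversions cs j ⊆ D.inversions cs j := by
    intro z hR
    have hz : D.rep cs z '' (⋃ y ∈ X, D.inversions cs y) = ⋃ y ∈ X, D.inversions cs y := by
      rw [Set.image_iUnion₂]
      exact Set.iUnion₂_congr hR
    have h1 := D.image_span_subset cs z hj.2
    rw [hz] at h1
    rintro _ ⟨v, hv, rfl⟩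
    exact D.mem_inversions_of_mem_span cs hj.1 (D.rep_mem_roots cs z hv.1.1) (h1 ⟨v, hv, rfl⟩)
  refine (key z hR).antisymm fun v hv => ?_
  exact ⟨_, key z⁻¹ (fun y hy => (hR y hy).inv) ⟨v, hv, rfl⟩, D.rep_rep_inv cs z v⟩

/-- The elements related to all elements of `X`, as a subgroup. -/
def daggerSubgroup (X : Set W) : Subgroup W where
  carrier := D.dagger cs X
  one_mem' x _ := D.R_one_right cs x
  mul_mem' h h' x hx := (h x hx).mul (h' x hx)
  inv_mem' h x hx := (h x hx).inv

theorem isLUB_mul_iff {x z : W} :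
    letI : PartialOrder W := cs.weakOrder
    (IsLUB {x, z} (z * x) ∧ D.inversions cs x ∩ D.inversions cs z = ∅) ↔
      D.inversions cs (z * x) = D.inversions cs z ∪ D.inversions cs x ∧
        Disjoint (D.inversions cs z) (D.inversions cs x) := by
  let : PartialOrder W := cs.weakOrder
  have hle : ∀ x y : W, x ≤ y ↔ D.inversions cs x ⊆ D.inversions cs y :=
    fun x y => D.weakOrder_le_iff cs
  rw [← Set.disjoint_iff_inter_eq_empty, disjoint_comm]
  refine and_congr_left fun hd => ⟨fun h => ?_, fun h => ⟨?_, fun y hy => ?_⟩⟩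
  · have hx := (hle _ _).mp (h.1 (Set.mem_insert x {z}))
    have hz := (hle _ _).mp (h.1 (Set.mem_insert_of_mem x rfl))
    -- The upper bound zx has at most l(z) + l(x) inversions, already filled by the disjoint sets
    -- Φ_z and Φ_x; leastness is not needed here.
    refine (((D.finite_inversions cs z).union
      (D.finite_inversions cs x)).eq_of_subset_of_encard_le (Set.union_subset hz hx) ?_).symm
    rw [Set.encard_union_eq hd, encard_inversions, encard_inversions, encard_inversions]
    exact_mod_cast cs.length_mul_le z x
  · rintro y (rfl | rfl) <;> rw [hle, h]
    · exact Set.subset_union_right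
    · exact Set.subset_union_left
  · rw [hle, h]
    exact Set.union_subset ((hle _ _).mp (hy (Set.mem_insert_of_mem x rfl)))
      ((hle _ _).mp (hy (Set.mem_insert x {z})))

end Relation

end BasedRootSystem

theorem theorem1p9 {B W V : Type*} [Group W] [AddCommGroup V] [Module ℝ V] {M : CoxeterMatrix B}
    (cs : CoxeterSystem M W) (D : BasedRootSystem M V) :
    letI : PartialOrder W := cs.weakOrder
    -- the relation `R` in terms of joins, and in terms of disjoint unions
    (∀ x z : W,
      (D.R cs x z ↔ IsLUB {x, z} (z * x) ∧ D.inversions cs x ∩ D.inversions cs z = ∅) ∧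
      ((IsLUB {x, z} (z * x) ∧ D.inversions cs x ∩ D.inversions cs z = ∅) ↔
        D.inversions cs (z * x) = D.inversions cs z ∪ D.inversions cs x ∧
          Disjoint (D.inversions cs z) (D.inversions cs x))) ∧
    (∀ x z : W, D.R cs x z →
      D.R cs x z⁻¹ ∧ cs.length (z * x) = cs.length z + cs.length x) ∧
    (∀ G ∈ D.stableDagger cs, ∃ H : Subgroup W, (H : Set W) = G) ∧
    (∀ L ∈ D.stableStar cs, IsCompleteMeetSubsemilattice L ∧ IsLeast L 1) ∧
    -- bounded subsets of a stable set have a join in `W`, which lies in the stable set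
    -- and is also the least upper bound within it
    (∀ L ∈ D.stableStar cs, ∀ X : Set W, X ⊆ L → BddAbove X →
      ∃ x ∈ L, IsLUB X x ∧ IsLeast {y | y ∈ L ∧ y ∈ upperBounds X} x) := by

  let : PartialOrder W := cs.weakOrder
  have hle : ∀ x y : W, x ≤ y ↔ D.inversions cs x ⊆ D.inversions cs y :=
    fun x y => D.weakOrder_le_iff cs
  refine ⟨fun x z => ⟨(D.R_iff_inversions_mul cs).trans (D.isLUB_mul_iff cs).symm,
    D.isLUB_mul_iff cs⟩, fun x z h => ⟨h.inv, (D.length_mul_eq_iff cs).mpr h.image_subset_posRoots⟩,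
    fun G hG => ⟨D.daggerSubgroup cs (D.star cs G), hG⟩, fun L hL => ⟨fun Y hYL hY => ?_, ?_, ?_⟩,
    fun L hL X hXL hX => ?_⟩
  · obtain ⟨m, hm⟩ := D.exists_meet cs hY
    refine ⟨m, ?_, fun y hy => (hle _ _).mpr ((hm m).mp subset_rfl y hy), fun x hx => ?_⟩
    · rw [BasedRootSystem.stableStar, Set.mem_ofPred_eq] at hL
      rw [← hL]
      exact fun z hz => D.R_meet cs hY (fun y hy => hz y (hYL hy)) hm
    · exact (hle _ _).mpr ((hm x).mpr fun y hy => (hle _ _).mp (hx hy))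
  · rw [BasedRootSystem.stableStar, Set.mem_ofPred_eq] at hL
    rw [← hL]
    exact fun z _ => D.R_one_left cs z
  · intro y _
    rw [hle, D.inversions_one]
    exact Set.empty_subset _
  · obtain ⟨u, hu⟩ := hX
    obtain ⟨j, hj⟩ := D.exists_isConicJoin cs (X := X) (u := u) fun y hy => (hle _ _).mp (hu hy)
    have hjL : j ∈ L := by
      rw [BasedRootSystem.stableStar, Set.mem_ofPred_eq] at hL
      rw [← hL]
      exact fun z hz => D.R_join cs (fun y hy => hz y (hXL hy)) hj
    exact ⟨j, hjL, hj.isLUB, ⟨hjL, hj.isLUB.1⟩, fun y hy => hj.isLUB.2 hy.2⟩
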